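/- Let $p$ be a prime and let $R$ be an F-finite reduced Noetherian commutative ring of characteristic $p$ (F-finite: the Frobenius $F\colon R\to R$, $x\mapsto x^p$, makes $R$ a finitely generated $R$-module). Let $R^\circ$ be the set of elements of $R$ that lie in no minimal prime ideal. A *graded family* $\mathfrak a_\bullet=\{\mathfrak a_m\}_{m\ge 1}$ of ideals of $R$ is a collection of ideals with $\mathfrak a_1\cap R^\circ\neq\emptyset$ and $\mathfrak a_k\mathfrak a_l\subseteq\mathfrak a_{k+l}$ for all $k,l\ge 1$; put $\mathfrak a_0=R$. For graded families $\mathfrak a_\bullet,\mathfrak b_\bullet$, the graded family $\mathfrak a_\bullet+\mathfrak b_\bullet$ is given by $(\mathfrak a_\bullet+\mathfrak b_\bullet)_m=\sum_{k+l=m,\ k,l\ge 0}\mathfrak a_k\mathfrak b_l$. Let $E=\bigoplus_{\mathfrak m}E_R(R/\mathfrak m)$ be the direct sum, over all maximal ideals $\mathfrak m$ of $R$, of the injective hulls of the residue fields. For $q=p^e$ let ${}^eR$ be $R$ viewed as an $R$-algebra via $F^e$, and for $z\in E$ let $z^q=1\otimes z\in \mathbb F^e(E)={}^eR\otimes_R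 E$, where $R$ acts on $\mathbb F^e(E)$ by multiplication on ${}^eR=R$. For real $t>0$ let $0_E^{*\mathfrak a_\bullet^t}$ be the set of $z\in E$ for which there is $c\in R^\circ$ with $c\,\mathfrak a_{\lceil tq\rceil}z^q=0$ for all large $q=p^e$. For real $\lambda,\mu\ge 0$ let $0_E^{*\mathfrak a_\bullet^\lambda\mathfrak b_\bullet^\mu}$ be the set of $z\in E$ for which there is $c\in R^\circ$ with $c\,\mathfrak a_{\lceil \lambda q\rceil}\mathfrak b_{\lceil\mu q\rceil}z^q=0$ for all large $q=p^e$. These are submodules of $E$; put $$\widetilde\tau(\mathfrak a_\bullet^t)=\operatorname{Ann}_R\bigl(0_E^{*\mathfrak a_\bullet^t}\bigr),\qquad \widetilde\tau(\mathfrak a_\bullet^\lambda\mathfrak b_\bullet^\mu)=\operatorname{Ann}_R\bigl(0_E^{*\mathfrak a_\bullet^\lambda\mathfrak b_\bullet^\mu}\bigr).$$ **Proposition.** For all graded families $\mathfrak a_\bullet,\mathfrak b_\bullet$ of ideals of $R$ and every real number $t>0$, $$\widetilde\tau\bigl((\mathfrak a_\bullet+\mathfrak b_\bullet)^t\bigr)=\sum_{\substack{\lambda,\mu\in\mathbb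 R_{\ge 0}\\ \lambda+\mu=t}}\widetilde\tau\bigl(\mathfrak a_\bullet^\lambda\mathfrak b_\bullet^\mu\bigr).$$ -/

import Mathlib

open scoped TensorProduct DirectSum

universe u

namespace AsymptoticTestIdeal

section InjectiveHull

variable (R : Type u) [CommRing R]

/-- `i : M → E` exhibits `E` as an injective hull of `M`: it is an injective map into an
injective module, and `E` is an essential extension of the image of `i`. -/
structure IsInjectiveHull {M E : Type u} [AddCommGroup M] [Module R M]
    [AddCommGroup E] [Module R E] (i : M →ₗ[R] E) : Prop where
  injective_map : Function.Injective i
  injective_module : Module.Injective R E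
  essential : ∀ K : Submodule R E, K ⊓ LinearMap.range i = ⊥ → K = ⊥

/-- Every module has an injective hull. -/
theorem exists_isInjectiveHull (M : Type u) [AddCommGroup M] [Module R M] :
    ∃ (E : Type u) (_ : AddCommGroup E) (_ : Module R E) (i : M →ₗ[R] E),
      IsInjectiveHull R i := by
  classical
  obtain ⟨I, _, _, hI, f, hf⟩ : ∃ (I : Type u) (_ : AddCommGroup I) (_ : Module R I)
      (_ : Module.Injective R I) (f : M →ₗ[R] I), Function.Injective f := by
    obtain ⟨J⟩ := CategoryTheory.EnoughInjectives.presentation (ModuleCat.of R M)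
    exact ⟨J.J, inferInstance, inferInstance,
      (Module.injective_iff_injective_object R J.J).2 J.injective,
      J.f.hom, (ModuleCat.mono_iff_injective J.f).1 J.mono⟩
  set P := LinearMap.range f with hP
  -- a maximal essential extension `N` of `P` inside `I`
  obtain ⟨N, hPN, hN⟩ := zorn_le_nonempty₀
    {N : Submodule R I | P ≤ N ∧ ∀ K ≤ N, K ⊓ P = ⊥ → K = ⊥} (by
      intro c hc hchain y hy
      refine ⟨sSup c, ⟨(hc hy).1.trans (le_sSup hy), fun K hK hKP => ?_⟩,
        fun z hz => le_sSup hz⟩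
      rw [eq_bot_iff]
      intro x hx
      obtain ⟨L, hL, hxL⟩ := (Submodule.mem_sSup_of_directed ⟨y, hy⟩ hchain.directedOn).1 (hK hx)
      have hspan : Submodule.span R {x} = ⊥ := by
        refine (hc hL).2 _ ((Submodule.span_singleton_le_iff_mem _ _).2 hxL) ?_
        rw [eq_bot_iff, ← hKP]
        exact inf_le_inf_right _ ((Submodule.span_singleton_le_iff_mem _ _).2 hx)
      rw [← hspan]
      exact Submodule.mem_span_singleton_self x) P
    ⟨le_rfl, fun K hK h => by rwa [inf_eq_left.2 hK] at h⟩
  -- a maximal submodule `C` with `C ⊓ N = ⊥`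
  obtain ⟨C, -, hC⟩ := zorn_le_nonempty₀ {C : Submodule R I | C ⊓ N = ⊥} (by
      intro c hc hchain y hy
      refine ⟨sSup c, ?_, fun z hz => le_sSup hz⟩
      change sSup c ⊓ N = ⊥
      rw [eq_bot_iff]
      rintro x ⟨hx, hxN⟩
      obtain ⟨L, hL, hxL⟩ := (Submodule.mem_sSup_of_directed ⟨y, hy⟩ hchain.directedOn).1 hx
      have h0 : L ⊓ N = ⊥ := hc hL
      rw [← h0]
      exact ⟨hxL, hxN⟩) ⊥ (by simp)
  have hC0 : C ⊓ N = ⊥ := hC.1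
  have hCmax : ∀ D : Submodule R I, C ≤ D → D ⊓ N = ⊥ → D ≤ C := fun D h1 h2 => hC.2 h2 h1
  obtain ⟨h, hh⟩ := hI.out (C.mkQ ∘ₗ N.subtype) (by
    rw [← LinearMap.ker_eq_bot, eq_bot_iff]
    rintro ⟨x, hx⟩ hxk
    have hxC : x ∈ C := by simpa using hxk
    have : x ∈ C ⊓ N := ⟨hxC, hx⟩
    rw [hC0] at this
    simpa using this) N.subtype
  set ψ : I →ₗ[R] I := h ∘ₗ C.mkQ with hψ
  have hψN : ∀ x ∈ N, ψ x = x := fun x hx => hh ⟨x, hx⟩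
  have hψC : ∀ x ∈ C, ψ x = 0 := fun x hx => by
    simp [hψ, (Submodule.Quotient.mk_eq_zero C).2 hx]
  have hNr : N ≤ LinearMap.range ψ := fun x hx => ⟨x, hψN x hx⟩
  have hess : ∀ L ≤ LinearMap.range ψ, L ⊓ N = ⊥ → L = ⊥ := by
    intro L hL hLN
    have hle : L.comap ψ ≤ C := by
      apply hCmax
      · intro x hx
        rw [Submodule.mem_comap, hψC x hx]
        exact L.zero_mem
      · rw [eq_bot_iff]
        rintro x ⟨hx, hxN⟩
        rw [SetLike.mem_coe, Submodule.mem_comap, hψN x hxN] at hx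
        rw [← hLN]
        exact ⟨hx, hxN⟩
    rw [eq_bot_iff]
    intro x hx
    obtain ⟨y, rfl⟩ := hL hx
    exact (Submodule.mem_bot R).2 (hψC y (hle hx))
  have hrN : LinearMap.range ψ ≤ N := by
    refine hN.2 ⟨hPN.trans hNr, fun K hK hKP => ?_⟩ hNr
    refine hess K hK (hN.1.2 _ inf_le_right ?_)
    rw [eq_bot_iff, ← hKP]
    exact inf_le_inf_right _ inf_le_left
  refine ⟨N, inferInstance, inferInstance, f.codRestrict N (fun x => hPN ⟨x, rfl⟩),
    ⟨fun x y hxy => hf (congrArg Subtype.val hxy), ⟨?_⟩, ?_⟩⟩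
  · intro X Y _ _ _ _ j hj g
    obtain ⟨k, hk⟩ := hI.out j hj (N.subtype ∘ₗ g)
    refine ⟨(ψ.codRestrict N fun x => hrN ⟨x, rfl⟩) ∘ₗ k, fun x => Subtype.ext ?_⟩
    change ψ (k (j x)) = g x
    rw [hk x]
    exact hψN _ (g x).2
  · intro K hK
    have hmap : K.map N.subtype = ⊥ := by
      refine hN.1.2 _ (Submodule.map_subtype_le N K) ?_
      rw [eq_bot_iff]
      rintro _ ⟨⟨x, hx, rfl⟩, ⟨m, hm⟩⟩
      have hxK : x ∈ K ⊓ LinearMap.range (f.codRestrict N (fun x => hPN ⟨x, rfl⟩)) :=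
        ⟨hx, ⟨m, Subtype.ext hm⟩⟩
      rw [hK, Submodule.mem_bot] at hxK
      simp [hxK]
    exact Submodule.map_injective_of_injective N.injective_subtype (by rw [hmap, Submodule.map_bot])

variable (M : Type u) [AddCommGroup M] [Module R M]

/-- The injective hull `E_R(M)` of an `R`-module `M` (unique up to isomorphism; a choice of it). -/
noncomputable def InjHull : Type u := (exists_isInjectiveHull R M).choose

noncomputable instance : AddCommGroup (InjHull R M) :=
  (exists_isInjectiveHull R M).choose_spec.choose

noncomputable instance : Module R (InjHull R M) :=
  (exists_isInjectiveHull R M).choose_spec.choose_spec.choose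

/-- The embedding of `M` into its injective hull. -/
noncomputable def InjHull.ι : M →ₗ[R] InjHull R M :=
  (exists_isInjectiveHull R M).choose_spec.choose_spec.choose_spec.choose

theorem InjHull.isInjectiveHull : IsInjectiveHull R (InjHull.ι R M) :=
  (exists_isInjectiveHull R M).choose_spec.choose_spec.choose_spec.choose_spec

/-- `E = ⨁_𝔪 E_R(R/𝔪)`, the direct sum over all maximal ideals of `R` of the injective hulls
of the residue fields. -/
abbrev ResidueHull : Type u :=
  ⨁ 𝔪 : MaximalSpectrum R, InjHull R (R ⧸ 𝔪.asIdeal)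

end InjectiveHull

/-- `R°`: the elements of `R` that lie in no minimal prime ideal, as a multiplicative set. -/
def ringCirc (R : Type u) [CommRing R] : Submonoid R where
  carrier := {c | ∀ P ∈ minimalPrimes R, c ∉ P}
  one_mem' := fun P hP h => hP.1.1.ne_top ((Ideal.eq_top_iff_one P).2 h)
  mul_mem' := fun ha hb P hP h => (hP.1.1.mem_or_mem h).elim (ha P hP) (hb P hP)

section Frobenius

variable (R : Type u) [CommRing R] (p : ℕ) [Fact p.Prime] [CharP R p]

/-- `R` is F-finite: the Frobenius `x ↦ x ^ p` makes `R` a finitely generated `R`-module. -/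
def IsFFinite : Prop := (frobenius R p).Finite

/-- `ᵉR`: the ring `R`, regarded as an `R`-algebra through the iterated Frobenius
`x ↦ x ^ (p ^ e)`. -/
@[nolint unusedArguments]
def FrobeniusRing (R : Type u) (_p _e : ℕ) : Type u := R

instance (e : ℕ) : CommRing (FrobeniusRing R p e) := inferInstanceAs (CommRing R)

noncomputable instance (e : ℕ) : Algebra R (FrobeniusRing R p e) :=
  (iterateFrobenius R p e).toAlgebra

/-- The identity map `R → ᵉR`, an isomorphism of rings (not of `R`-modules). -/
def toFrob (e : ℕ) : R ≃+* FrobeniusRing R p e := RingEquiv.refl R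

theorem algebraMap_frobeniusRing (e : ℕ) (r : R) :
    algebraMap R (FrobeniusRing R p e) r = toFrob R p e (r ^ p ^ e) := rfl

/-- The Frobenius (Peskine-Szpiro) functor `𝔽ᵉ(M) = ᵉR ⊗_R M`. Its `R`-module structure is the one
coming from `ᵉR = R`, that is, from multiplication on the left tensor factor. -/
abbrev FrobeniusPullback (e : ℕ) (M : Type u) [AddCommGroup M] [Module R M] : Type u :=
  FrobeniusRing R p e ⊗[R] M

variable {M : Type u} [AddCommGroup M] [Module R M]

/-- For `x : R` and `z : M`, the element `x z^q` of `𝔽ᵉ(M)`, where `q = p ^ e` and `z^q = 1 ⊗ z` is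
the image of `z` under the iterated Frobenius map `M → 𝔽ᵉ(M)`. -/
noncomputable def mulPow (e : ℕ) (x : R) (z : M) : FrobeniusPullback R p e M :=
  toFrob R p e x • ((1 : FrobeniusRing R p e) ⊗ₜ[R] z)

theorem mulPow_eq (e : ℕ) (x : R) (z : M) : mulPow R p e x z = toFrob R p e x ⊗ₜ[R] z := by
  simp [mulPow, TensorProduct.smul_tmul']

theorem mulPow_mul (e : ℕ) (y x : R) (z : M) :
    mulPow R p e (y * x) z = toFrob R p e y • mulPow R p e x z := by
  simp [mulPow, mul_smul]

theorem mulPow_smul (e : ℕ) (x r : R) (z : M) :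
    mulPow R p e x (r • z) = toFrob R p e (r ^ p ^ e) • mulPow R p e x z := by
  rw [mulPow_eq, mulPow_eq, TensorProduct.tmul_smul, TensorProduct.smul_tmul',
    TensorProduct.smul_tmul', Algebra.smul_def, algebraMap_frobeniusRing, smul_eq_mul]

/-- The tight closure of the zero submodule of `M` with respect to a sequence of ideals
`(J_e)_{e ≥ 0}`: the submodule of all `z ∈ M` for which there is `c ∈ R°` with
`c J_e z^q = 0` in `𝔽ᵉ(M)` for all large `q = p ^ e`. -/
noncomputable def zeroTightClosure (J : ℕ → Ideal R) (M : Type u) [AddCommGroup M] [Module R M] :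
    Submodule R M where
  carrier := {z | ∃ c ∈ ringCirc R, ∃ e₀ : ℕ, ∀ e ≥ e₀, ∀ x ∈ J e, mulPow R p e (c * x) z = 0}
  zero_mem' := ⟨1, one_mem _, 0, fun e _ x _ => by simp [mulPow]⟩
  add_mem' := by
    rintro z w ⟨c, hc, e₀, hz⟩ ⟨d, hd, e₁, hw⟩
    refine ⟨c * d, mul_mem hc hd, max e₀ e₁, fun e he x hx => ?_⟩
    have h1 : mulPow R p e (c * d * x) z = 0 := by
      rw [show c * d * x = d * (c * x) by ring, mulPow_mul,
        hz e (le_of_max_le_left he) x hx, smul_zero]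
    have h2 : mulPow R p e (c * d * x) w = 0 := by
      rw [show c * d * x = c * (d * x) by ring, mulPow_mul,
        hw e (le_of_max_le_right he) x hx, smul_zero]
    rw [mulPow_eq] at h1 h2 ⊢
    rw [TensorProduct.tmul_add, h1, h2, add_zero]
  smul_mem' := by
    rintro r z ⟨c, hc, e₀, hz⟩
    exact ⟨c, hc, e₀, fun e he x hx => by rw [mulPow_smul, hz e he x hx, smul_zero]⟩

end Frobenius

/-- A graded family of ideals `𝔞_• = {𝔞_m}`: `𝔞_1` meets `R°` and `𝔞_k 𝔞_l ⊆ 𝔞_{k+l}`,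
with the convention `𝔞_0 = R`. -/
structure GradedFamily (R : Type u) [CommRing R] where
  ideal : ℕ → Ideal R
  ideal_zero : ideal 0 = ⊤
  exists_mem_one : ∃ x ∈ ideal 1, x ∈ ringCirc R
  mul_le : ∀ k l : ℕ, 1 ≤ k → 1 ≤ l → ideal k * ideal l ≤ ideal (k + l)

namespace GradedFamily

variable {R : Type u} [CommRing R]

theorem mul_le' (𝔞 : GradedFamily R) (k l : ℕ) : 𝔞.ideal k * 𝔞.ideal l ≤ 𝔞.ideal (k + l) := by
  rcases Nat.eq_zero_or_pos k with rfl | hk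
  · rw [zero_add, 𝔞.ideal_zero, Ideal.top_mul]
  rcases Nat.eq_zero_or_pos l with rfl | hl
  · rw [add_zero, 𝔞.ideal_zero, Ideal.mul_top]
  exact 𝔞.mul_le k l hk hl

/-- The graded family `𝔞_• + 𝔟_•`, with `(𝔞_• + 𝔟_•)_m = ∑_{k+l=m} 𝔞_k 𝔟_l`, where `k, l ≥ 0`. -/
instance : Add (GradedFamily R) where
  add 𝔞 𝔟 :=
    { ideal := fun m => ∑ kl ∈ Finset.HasAntidiagonal.antidiagonal m, 𝔞.ideal kl.1 * 𝔟.ideal kl.2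
      ideal_zero := by simp [𝔞.ideal_zero, 𝔟.ideal_zero]
      exists_mem_one := by
        obtain ⟨x, hx, hx'⟩ := 𝔞.exists_mem_one
        refine ⟨x, ?_, hx'⟩
        rw [Ideal.sum_eq_sup]
        refine Finset.le_sup (f := fun kl : ℕ × ℕ => 𝔞.ideal kl.1 * 𝔟.ideal kl.2)
          (b := ((1, 0) : ℕ × ℕ)) (by simp) ?_
        simpa [𝔟.ideal_zero] using hx
      mul_le := by
        intro m n _ _
        rw [Finset.sum_mul_sum, Ideal.sum_eq_sup]
        refine Finset.sup_le fun i hi => ?_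
        rw [Ideal.sum_eq_sup]
        refine Finset.sup_le fun j hj => ?_
        rw [Finset.HasAntidiagonal.mem_antidiagonal] at hi hj
        rw [Ideal.sum_eq_sup, mul_mul_mul_comm]
        refine (Ideal.mul_mono (𝔞.mul_le' _ _) (𝔟.mul_le' _ _)).trans ?_
        exact Finset.le_sup (f := fun kl : ℕ × ℕ => 𝔞.ideal kl.1 * 𝔟.ideal kl.2)
          (b := (i.1 + j.1, i.2 + j.2)) (by rw [Finset.HasAntidiagonal.mem_antidiagonal]; omega) }

theorem add_ideal (𝔞 𝔟 : GradedFamily R) (m : ℕ) :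
    (𝔞 + 𝔟).ideal m = ∑ kl ∈ Finset.HasAntidiagonal.antidiagonal m, 𝔞.ideal kl.1 * 𝔟.ideal kl.2 := rfl

end GradedFamily

section TestIdeal

variable {R : Type u} [CommRing R] (p : ℕ) [Fact p.Prime] [CharP R p]

/-- `τ̃(𝔞_•^t) = Ann_R(0_E^{*𝔞_•^t})`, where `z ∈ 0_E^{*𝔞_•^t}` means that there is `c ∈ R°` with
`c 𝔞_{⌈tq⌉} z^q = 0` for all large `q = p ^ e`. -/
noncomputable def testIdeal (𝔞 : GradedFamily R) (t : ℝ) : Ideal R :=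
  (zeroTightClosure R p (fun e => 𝔞.ideal ⌈t * (p : ℝ) ^ e⌉₊) (ResidueHull R)).annihilator

/-- The mixed ideal `τ̃(𝔞_•^s 𝔟_•^t) = Ann_R(0_E^{*𝔞_•^s 𝔟_•^t})`, where `z ∈ 0_E^{*𝔞_•^s 𝔟_•^t}`
means that there is `c ∈ R°` with `c 𝔞_{⌈sq⌉} 𝔟_{⌈tq⌉} z^q = 0` for all large `q = p ^ e`. -/
noncomputable def mixedTestIdeal (𝔞 𝔟 : GradedFamily R) (s t : ℝ) : Ideal R :=
  (zeroTightClosure R p (fun e => 𝔞.ideal ⌈s * (p : ℝ) ^ e⌉₊ * 𝔟.ideal ⌈t * (p : ℝ) ^ e⌉₊)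
    (ResidueHull R)).annihilator

end TestIdeal

end AsymptoticTestIdeal

namespace AsymptoticTestIdeal

/-! Duality removes `E`: `r` lies in the test ideal of a sequence `J_e` iff, for all `d ∈ R°` and
`e₀`, it lies in the ideal generated by the values `φ(d x)` with `x ∈ J_e`, `e ≥ e₀` and `φ` a
`p^{-e}`-linear map (`mem_annihilator_zeroTightClosure_iff`).

A uniform `c ∈ R°` is a value at every `d ∈ R°` for arbitrarily large exponents
(`exists_uniform_test_element`). If `x ∈ 𝔞_m` with `m ≥ t p^e` and `u ∈ 𝔞_1 ∩ R°`, write `c = ψ(d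
u^m)` with `ψ` being `p^{-f}`-linear. Then `c x = ψ(d u^m x^(p^f))`, and `u^m x^(p^f)` lies in `𝔞_n`
for `n = ⌈t p^(e+f)⌉`. So all `φ(c x)` lie in the test ideal, and these values generate it.

Both inclusions are now checked on products `x y` with `x ∈ 𝔞_k`, `y ∈ 𝔟_l`. If `k + l = ⌈tq⌉`, then
`t = r + s` with `rq ≤ k` and `sq ≤ l`; conversely `⌈rq⌉ + ⌈sq⌉ ≥ (r + s)q`. -/

theorem ringCirc_le_nonZeroDivisors (R : Type u) [CommRing R] [IsReduced R] :
    ringCirc R ≤ nonZeroDivisors R := by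
  intro c hc
  rw [mem_nonZeroDivisors_iff_right]
  intro x hx
  have hmem : x ∈ sInf (minimalPrimes R) := by
    rw [Ideal.mem_sInf]
    intro P hP
    have h0 : x * c ∈ P := hx ▸ P.zero_mem
    exact (hP.1.1.mem_or_mem h0).resolve_right (hc P hP)
  rw [minimalPrimes, Ideal.sInf_minimalPrimes] at hmem
  have hnil : IsNilpotent x := mem_nilradical.1 hmem
  exact hnil.eq_zero

/-! ### Finite modules are projective after inverting `R°`. -/

section GenericProjectivity

variable (R : Type u) [CommRing R] [IsNoetherianRing R]

/-- A prime disjoint from `R°` lies in the union of the finitely many minimal primes, so by prime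
avoidance it is itself minimal. -/
theorem krullDimLE_zero_localization_ringCirc : Ring.KrullDimLE 0 (Localization (ringCirc R)) := by
  rw [Ring.krullDimLE_zero_iff]
  intro Q hQ
  obtain ⟨M, hM, hQM⟩ := Q.exists_le_maximal hQ.ne_top
  have key : ∀ P : Ideal (Localization (ringCirc R)), P.IsPrime →
      P.comap (algebraMap R _) ∈ minimalPrimes R := by
    intro P hP
    have hdisj := ((IsLocalization.isPrime_iff_isPrime_disjoint (ringCirc R) _ P).1 hP).2
    have hsub : (P.comap (algebraMap R (Localization (ringCirc R))) : Set R) ⊆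
        ⋃ p ∈ ((minimalPrimes.finite_of_isNoetherianRing R).toFinset : Set (Ideal R)),
          (p : Set R) := by
      intro x hx
      by_contra hcon
      refine Set.disjoint_left.1 hdisj ?_ hx
      intro p hp hxp
      exact hcon (Set.mem_biUnion (by simpa using hp) hxp)
    obtain ⟨p, hp, hle⟩ := (Ideal.subset_union_prime (f := fun p : Ideal R => p) ⊥ ⊥
      (fun p hp _ _ => by
        have : p ∈ minimalPrimes R := by simpa using hp
        exact this.1.1)).1 hsub
    have hp' : p ∈ minimalPrimes R := by simpa using hp
    have hPp : (P.comap (algebraMap R (Localization (ringCirc R)))).IsPrime := hP.comap _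
    have := hp'.2 ⟨hPp, bot_le⟩ hle
    rwa [le_antisymm hle this]
  have hQc := key Q hQ
  have hMc := key M hM.isPrime
  have hle : Q.comap (algebraMap R (Localization (ringCirc R))) ≤ M.comap (algebraMap R _) :=
    Ideal.comap_mono hQM
  have hge := hMc.2 ⟨hQc.1.1, bot_le⟩ hle
  have : Q = M := by
    rw [← IsLocalization.map_under (ringCirc R) _ Q, ← IsLocalization.map_under (ringCirc R) _ M]
    exact congrArg _ (le_antisymm hle hge)
  rwa [this]

/-- Up to an element of `R°`, a finitely generated module over a reduced Noetherian ring has a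
finite dual basis. -/
theorem exists_dualBasis_up_to_ringCirc [IsReduced R] (M : Type u) [AddCommGroup M] [Module R M]
    [Module.Finite R M] :
    ∃ c ∈ ringCirc R, ∃ (n : ℕ) (v : Fin n → M) (φ : Fin n → M →ₗ[R] R),
      ∀ x, c • x = ∑ i, φ i x • v i := by
  have := krullDimLE_zero_localization_ringCirc R
  have : IsNoetherianRing (Localization (ringCirc R)) :=
    IsLocalization.isNoetherianRing (ringCirc R) _ inferInstance
  have : IsArtinianRing (Localization (ringCirc R)) :=
    IsNoetherianRing.isArtinianRing_of_krullDimLE_zero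
  have : IsReduced (Localization (ringCirc R)) :=
    isReduced_localizationPreserves (ringCirc R) _ inferInstance
  have : IsSemisimpleRing (Localization (ringCirc R)) :=
    IsArtinianRing.isSemisimpleRing_of_isReduced _
  obtain ⟨n, s, hs⟩ := Module.Finite.exists_fin' R M
  have : Module.Projective (Localization (ringCirc R)) (LocalizedModule (ringCirc R) M) :=
    Module.projective_of_isSemisimpleRing _ _
  have hsurj := LocalizedModule.map_surjective (ringCirc R) s hs
  -- The presentation `s` splits over the semisimple localization; `w` clears the denominators of
  -- the splitting, and `w'` turns the resulting identity into one in `M` itself.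
  obtain ⟨σ, hσ⟩ := Module.projective_lifting_property
    (LocalizedModule.map (ringCirc R) s) LinearMap.id hsurj
  have : Module.FinitePresentation R M := Module.finitePresentation_of_finite R M
  obtain ⟨h, w, hw⟩ := Module.FinitePresentation.exists_lift_of_isLocalizedModule (ringCirc R)
    (LocalizedModule.mkLinearMap (ringCirc R) (Fin n → R))
    (σ.restrictScalars R ∘ₗ LocalizedModule.mkLinearMap (ringCirc R) M)
  have hcomp : LocalizedModule.mkLinearMap (ringCirc R) M ∘ₗ (s ∘ₗ h) =
      LocalizedModule.mkLinearMap (ringCirc R) M ∘ₗ (w.1 • LinearMap.id) := by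
    ext x
    have h1 : LocalizedModule.mkLinearMap (ringCirc R) (Fin n → R) (h x) =
        w • σ (LocalizedModule.mkLinearMap (ringCirc R) M x) := LinearMap.congr_fun hw x
    have h2 := congrArg (LocalizedModule.map (ringCirc R) s) h1
    have h3 := LinearMap.congr_fun hσ (LocalizedModule.mkLinearMap (ringCirc R) M x)
    simp only [LinearMap.comp_apply, LinearMap.id_apply] at h3
    rw [Submonoid.smul_def, LinearMap.map_smul_of_tower, h3] at h2
    simpa [LocalizedModule.map_mk, LocalizedModule.mkLinearMap_apply] using h2
  obtain ⟨w', hw'⟩ := Module.Finite.exists_smul_of_comp_eq_of_isLocalizedModule (ringCirc R)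
    (LocalizedModule.mkLinearMap (ringCirc R) M) _ _ hcomp
  refine ⟨w' * w, mul_mem w'.2 w.2, n, fun i => s (Pi.single i 1),
    fun i => w'.1 • (LinearMap.proj i ∘ₗ h), fun x => ?_⟩
  have h4 : w'.1 • s (h x) = w'.1 • w.1 • x := LinearMap.congr_fun hw' x
  rw [mul_smul, ← h4]
  conv_lhs => rw [pi_eq_sum_univ' (h x)]
  simp [map_sum, map_smul, Finset.smul_sum, mul_smul]

end GenericProjectivity

/-! ### Duality with injective modules and cogeneration. -/

section Duality

variable {R : Type u} [CommRing R]

/-- For `M` finitely generated over a Noetherian ring and `E` injective, the natural map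
`M ⊗ E → Hom(Hom(M, R), E)` is injective on pure tensors. -/
theorem tmul_eq_zero_of_forall_dual [IsNoetherianRing R] {M E : Type u} [AddCommGroup M]
    [Module R M] [Module.Finite R M] [AddCommGroup E] [Module R E] (hE : Module.Injective R E)
    (m : M) (z : E) (h : ∀ φ : M →ₗ[R] R, φ m • z = 0) : m ⊗ₜ[R] z = 0 := by
  obtain ⟨n, s, hs⟩ := Module.Finite.exists_fin' R M
  obtain ⟨k, g', hg'⟩ := Module.Finite.exists_fin' R (LinearMap.ker s)
  let g : (Fin k → R) →ₗ[R] (Fin n → R) := (LinearMap.ker s).subtype ∘ₗ g'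
  have hsg : ∀ x, s (g x) = 0 := fun x => (g' x).2
  obtain ⟨v, rfl⟩ := hs m
  let T : ((Fin n → R) →ₗ[R] R) →ₗ[R] ((Fin k → R) →ₗ[R] R) := LinearMap.lcomp R R g
  let β : ((Fin n → R) →ₗ[R] R) →ₗ[R] E :=
    (LinearMap.toSpanSingleton R E z) ∘ₗ (LinearMap.applyₗ v)
  -- A functional vanishing on the relations descends to `M`, where `h` applies. Hence `β` factors
  -- through the image of `T`, and injectivity of `E` extends it to `f`.
  have hker : LinearMap.ker T ≤ LinearMap.ker β := by
    intro φ hφ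
    have hφs : LinearMap.ker s ≤ LinearMap.ker φ := by
      intro x hx
      obtain ⟨y, hy⟩ := hg' ⟨x, hx⟩
      have hgy : g y = x := congrArg Subtype.val hy
      have := LinearMap.congr_fun (LinearMap.mem_ker.1 hφ) y
      rw [LinearMap.mem_ker, ← hgy]
      exact this
    let φ' : M →ₗ[R] R := (LinearMap.ker s).liftQ φ hφs ∘ₗ
      (s.quotKerEquivOfSurjective hs).symm.toLinearMap
    have hφ' : φ' (s v) = φ v := by
      have : (s.quotKerEquivOfSurjective hs).symm (s v) = Submodule.Quotient.mk v := by
        rw [LinearEquiv.symm_apply_eq]; rfl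
      simp [φ', this]
    have := h φ'
    rw [hφ'] at this
    exact this
  obtain ⟨f, hf⟩ := hE.out ((LinearMap.ker T).liftQ T le_rfl)
    (LinearMap.ker_eq_bot.1 (Submodule.ker_liftQ_eq_bot _ _ _ le_rfl))
    ((LinearMap.ker T).liftQ β hker)
  have hf' : ∀ φ : (Fin n → R) →ₗ[R] R, f (φ ∘ₗ g) = φ v • z := fun φ => hf (Submodule.Quotient.mk φ)
  -- The `w j` express the vector `(v i • z)` as a combination of relations among the generators of
  -- `M`, which makes the tensor vanish.
  let w : Fin k → E := fun j => f (LinearMap.proj j)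
  have hfw : ∀ ψ : (Fin k → R) →ₗ[R] R, f ψ = ∑ j, ψ (Pi.single j 1) • w j := by
    intro ψ
    have : ψ = ∑ j, ψ (Pi.single j 1) • (LinearMap.proj j : (Fin k → R) →ₗ[R] R) := by
      refine LinearMap.ext fun x => ?_
      conv_lhs => rw [pi_eq_sum_univ' x]
      simp [mul_comm]
    conv_lhs => rw [this]
    simp [w]
  have hs_sum : ∀ x : Fin n → R, s x = ∑ i, x i • s (Pi.single i 1) := by
    intro x
    conv_lhs => rw [pi_eq_sum_univ' x]
    simp
  calc s v ⊗ₜ[R] z = ∑ i, s (Pi.single i 1) ⊗ₜ[R] (v i • z) := by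
        rw [hs_sum v, TensorProduct.sum_tmul]
        exact Finset.sum_congr rfl fun i _ => TensorProduct.smul_tmul _ _ _
    _ = ∑ i, ∑ j, ((g (Pi.single j 1)) i • s (Pi.single i 1)) ⊗ₜ[R] w j := by
        refine Finset.sum_congr rfl fun i _ => ?_
        have := hf' (LinearMap.proj i)
        rw [LinearMap.proj_apply] at this
        rw [← this, hfw, TensorProduct.tmul_sum]
        exact Finset.sum_congr rfl fun j _ => (TensorProduct.smul_tmul _ _ _).symm
    _ = ∑ j, s (g (Pi.single j 1)) ⊗ₜ[R] w j := by
        rw [Finset.sum_comm]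
        refine Finset.sum_congr rfl fun j _ => ?_
        rw [hs_sum (g _), TensorProduct.sum_tmul]
    _ = 0 := by simp [hsg]

/-- `⨁ E_R(R/𝔪)` cogenerates: every ideal is the annihilator of its annihilator in it. -/
theorem exists_residueHull_smul_ne_zero (I : Ideal R) {r : R} (hr : r ∉ I) :
    ∃ z : ResidueHull R, (∀ y ∈ I, y • z = 0) ∧ r • z ≠ 0 := by
  classical
  -- The kernel is `(I : r)`. The map `R/(I : r) → R/m → E(R/m)` extends along `R/(I : r) ↪ R/I`;
  -- the image of `1` is the required `z`.
  let f : R →ₗ[R] R ⧸ I := LinearMap.toSpanSingleton R _ (Ideal.Quotient.mk I r)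
  have hne : LinearMap.ker f ≠ ⊤ := by
    intro htop
    have h1 : (1 : R) ∈ LinearMap.ker f := htop ▸ Submodule.mem_top
    rw [LinearMap.mem_ker, LinearMap.toSpanSingleton_apply, one_smul,
      Ideal.Quotient.eq_zero_iff_mem] at h1
    exact hr h1
  obtain ⟨m, hm, hle⟩ := Ideal.exists_le_maximal (LinearMap.ker f) hne
  have hull := InjHull.isInjectiveHull R (R ⧸ m)
  obtain ⟨h, hh⟩ := hull.injective_module.out ((LinearMap.ker f).liftQ f le_rfl)
    (LinearMap.ker_eq_bot.1 (Submodule.ker_liftQ_eq_bot _ _ _ le_rfl))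
    (InjHull.ι R (R ⧸ m) ∘ₗ Submodule.factor hle)
  have h1 := hh (Submodule.Quotient.mk 1)
  simp only [Submodule.liftQ_apply, LinearMap.comp_apply, f, LinearMap.toSpanSingleton_apply,
    one_smul] at h1
  refine ⟨DirectSum.lof R (MaximalSpectrum R) (fun 𝔪 => InjHull R (R ⧸ 𝔪.asIdeal)) ⟨m, hm⟩
    (h (Ideal.Quotient.mk I 1)), fun y hy => ?_, fun h0 => ?_⟩
  · have : y • (Ideal.Quotient.mk I 1) = 0 := by
      rw [← Ideal.Quotient.mk_eq_mk, ← Submodule.Quotient.mk_smul, Submodule.Quotient.mk_eq_zero]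
      simpa using hy
    rw [← map_smul, ← map_smul, this, map_zero, map_zero]
  · have : r • (Ideal.Quotient.mk I 1) = Ideal.Quotient.mk I r := by
      rw [← Ideal.Quotient.mk_eq_mk, ← Submodule.Quotient.mk_smul]
      simp
    rw [← map_smul, ← map_smul, this, h1] at h0
    have h2 := DirectSum.of_injective (β := fun 𝔪 : MaximalSpectrum R =>
      InjHull R (R ⧸ 𝔪.asIdeal)) ⟨m, hm⟩ (h0.trans (map_zero _).symm)
    have h3 := hull.injective_map (h2.trans (map_zero _).symm)
    have h4 : (Ideal.Quotient.mk m 1) = 0 := h3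
    rw [Ideal.Quotient.eq_zero_iff_mem] at h4
    exact hm.ne_top ((Ideal.eq_top_iff_one m).2 h4)

end Duality

/-! ### Calculus of `p^{-e}`-linear maps. -/

section CartierMap

variable {R : Type u} [CommRing R] (p : ℕ)

/-- `p^{-e}`-linear maps, that is, `R`-linear maps `ᵉR → R`. -/
def IsCartierMap (e : ℕ) (φ : R →+ R) : Prop := ∀ r x, φ (r ^ p ^ e * x) = r * φ x

variable {p}

theorem IsCartierMap.comp {e f : ℕ} {φ ψ : R →+ R} (hφ : IsCartierMap p e φ)
    (hψ : IsCartierMap p f ψ) : IsCartierMap p (e + f) (φ.comp ψ) := by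
  intro r x
  simp only [AddMonoidHom.comp_apply]
  rw [pow_add, pow_mul, hψ, hφ]

theorem IsCartierMap.mulLeft {e : ℕ} {φ : R →+ R} (hφ : IsCartierMap p e φ) (a : R) :
    IsCartierMap p e ((AddMonoidHom.mulLeft a).comp φ) := by
  intro r x
  simp only [AddMonoidHom.comp_apply, AddMonoidHom.coe_mulLeft]
  rw [hφ, mul_left_comm]

theorem IsCartierMap.comp_mulLeft {e : ℕ} {φ : R →+ R} (hφ : IsCartierMap p e φ) (a : R) :
    IsCartierMap p e (φ.comp (AddMonoidHom.mulLeft a)) := by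
  intro r x
  simp only [AddMonoidHom.comp_apply, AddMonoidHom.coe_mulLeft]
  rw [mul_left_comm, hφ]

variable (p)

/-- The ideal of all values at `x` of the `p^{-e}`-linear maps. -/
def cartierEval (e : ℕ) (x : R) : Ideal R where
  carrier := {y | ∃ φ : R →+ R, IsCartierMap p e φ ∧ φ x = y}
  zero_mem' := ⟨0, fun r x => by simp, rfl⟩
  add_mem' := by
    rintro _ _ ⟨φ, hφ, rfl⟩ ⟨ψ, hψ, rfl⟩
    exact ⟨φ + ψ, fun r x => by simp [hφ r x, hψ r x, mul_add], rfl⟩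
  smul_mem' := by
    rintro a _ ⟨φ, hφ, rfl⟩
    exact ⟨_, hφ.mulLeft a, rfl⟩

/-- The ideal generated by the values on `d J_e` of all `p^{-e}`-linear maps with `e ≥ e₀`. -/
def cartierSum (J : ℕ → Ideal R) (d : R) (e₀ : ℕ) : Ideal R :=
  ⨆ (e : ℕ) (_ : e₀ ≤ e) (x : R) (_ : x ∈ J e), cartierEval p e (d * x)

variable {p}

theorem mem_cartierEval_zero (x : R) : x ∈ cartierEval p 0 x :=
  ⟨AddMonoidHom.id R, fun r x => by simp, rfl⟩

theorem cartierEval_trans {e f : ℕ} {x y z : R} (hz : z ∈ cartierEval p e y)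
    (hy : y ∈ cartierEval p f x) : z ∈ cartierEval p (e + f) x := by
  obtain ⟨φ, hφ, rfl⟩ := hz
  obtain ⟨ψ, hψ, rfl⟩ := hy
  exact ⟨_, hφ.comp hψ, rfl⟩

theorem cartierEval_mul_le (e : ℕ) (a x : R) : cartierEval p e (a * x) ≤ cartierEval p e x := by
  rintro _ ⟨φ, hφ, rfl⟩
  exact ⟨_, hφ.comp_mulLeft a, rfl⟩

theorem mul_mem_cartierEval {e : ℕ} {x y : R} (r : R) (hy : y ∈ cartierEval p e x) :
    r * y ∈ cartierEval p e (r ^ p ^ e * x) := by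
  obtain ⟨φ, hφ, rfl⟩ := hy
  exact ⟨φ, hφ, hφ r x⟩

theorem cartierEval_le_cartierSum {J : ℕ → Ideal R} (d : R) {e₀ e : ℕ} (he : e₀ ≤ e) {x : R}
    (hx : x ∈ J e) : cartierEval p e (d * x) ≤ cartierSum p J d e₀ :=
  le_iSup₂_of_le e he (le_iSup₂_of_le x hx le_rfl)

end CartierMap

/-! ### Test ideals through Cartier maps. -/

section FrobeniusRing

variable {R : Type u} [CommRing R] {p : ℕ} [Fact p.Prime] [CharP R p]

theorem smul_toFrob (e : ℕ) (r x : R) : r • toFrob R p e x = toFrob R p e (r ^ p ^ e * x) := by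
  rw [Algebra.smul_def, algebraMap_frobeniusRing, map_mul]

theorem isCartierMap_of_linearMap {e : ℕ} (φ : FrobeniusRing R p e →ₗ[R] R) :
    IsCartierMap p e (φ.toAddMonoidHom.comp (toFrob R p e : R →+ FrobeniusRing R p e)) := by
  intro r x
  change φ (toFrob R p e (r ^ p ^ e * x)) = r * φ (toFrob R p e x)
  rw [← smul_toFrob, map_smul, smul_eq_mul]

/-- A `p^{-e}`-linear map, as a linear map on `ᵉR`. -/
noncomputable def IsCartierMap.toLinearMap {e : ℕ} {φ : R →+ R} (hφ : IsCartierMap p e φ) :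
    FrobeniusRing R p e →ₗ[R] R where
  toFun x := φ ((toFrob R p e).symm x)
  map_add' x y := by simp
  map_smul' r x := by
    obtain ⟨y, rfl⟩ := (toFrob R p e).surjective x
    rw [smul_toFrob]
    simpa using hφ r y

theorem finite_frobeniusRing (hF : IsFFinite R p) (e : ℕ) :
    Module.Finite R (FrobeniusRing R p e) := by
  have h : (iterateFrobenius R p e).Finite := by
    induction e with
    | zero =>
      rw [iterateFrobenius_zero]
      exact RingHom.Finite.id R
    | succ e ih =>
      have : iterateFrobenius R p (e + 1) = (iterateFrobenius R p e).comp (frobenius R p) := by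
        ext x
        simp [iterateFrobenius_def, frobenius_def, pow_succ', pow_mul]
      rw [this]
      exact ih.comp hF
  exact h

/-- A `p^{-e}`-linear map induces `ᵉR ⊗ E → E`, giving one direction. The converse is
`tmul_eq_zero_of_forall_dual`, applied to each summand, so that only the single hulls need be
injective. -/
theorem mulPow_eq_zero_iff [IsNoetherianRing R] (hF : IsFFinite R p) (e : ℕ) (x : R)
    (z : ResidueHull R) :
    mulPow R p e x z = 0 ↔ ∀ y ∈ cartierEval p e x, y • z = 0 := by
  classical
  rw [mulPow_eq]
  constructor
  · rintro h _ ⟨φ, hφ, rfl⟩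
    have := congrArg (TensorProduct.lift ((LinearMap.lsmul R (ResidueHull R)) ∘ₗ hφ.toLinearMap)) h
    simpa [IsCartierMap.toLinearMap] using this
  · intro h
    have := finite_frobeniusRing hF e
    have key : ∀ 𝔪 : MaximalSpectrum R, toFrob R p e x ⊗ₜ[R] (z 𝔪) = 0 := by
      intro 𝔪
      refine tmul_eq_zero_of_forall_dual
        (InjHull.isInjectiveHull R (R ⧸ 𝔪.asIdeal)).injective_module _ _ fun φ => ?_
      have h1 := h _ ⟨_, isCartierMap_of_linearMap φ, rfl⟩
      exact DFunLike.congr_fun h1 𝔪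
    rw [← DirectSum.sum_support_of z, TensorProduct.tmul_sum]
    refine Finset.sum_eq_zero fun 𝔪 _ => ?_
    have := congrArg (LinearMap.lTensor (FrobeniusRing R p e)
      (DirectSum.lof R (MaximalSpectrum R) (fun 𝔪 => InjHull R (R ⧸ 𝔪.asIdeal)) 𝔪)) (key 𝔪)
    rwa [LinearMap.lTensor_tmul, map_zero] at this

/-- The tight closure is the union over `d`, `e₀` of the annihilators in `E` of the Cartier sums; as
`E` cogenerates, its annihilator is the intersection of those sums. -/
theorem mem_annihilator_zeroTightClosure_iff [IsNoetherianRing R] (hF : IsFFinite R p)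
    (J : ℕ → Ideal R) (r : R) :
    r ∈ (zeroTightClosure R p J (ResidueHull R)).annihilator ↔
      ∀ d ∈ ringCirc R, ∀ e₀, r ∈ cartierSum p J d e₀ := by
  rw [Submodule.mem_annihilator]
  constructor
  · intro h d hd e₀
    by_contra hr
    obtain ⟨z, hz, hrz⟩ := exists_residueHull_smul_ne_zero _ hr
    refine hrz (h z ⟨d, hd, e₀, fun e he x hx => ?_⟩)
    exact (mulPow_eq_zero_iff hF _ _ _).2 fun y hy => hz y (cartierEval_le_cartierSum d he hx hy)
  · rintro h z ⟨d, hd, e₀, hz⟩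
    have hle : cartierSum p J d e₀ ≤ LinearMap.ker (LinearMap.toSpanSingleton R _ z) :=
      iSup₂_le fun e he => iSup₂_le fun x hx => fun y hy =>
        (mulPow_eq_zero_iff hF _ _ _).1 (hz e he x hx) y hy
    exact hle (h d hd e₀)

theorem map_iterateFrobenius_le_pow (I : Ideal R) (e : ℕ) :
    I.map (iterateFrobenius R p e) ≤ I ^ p ^ e := by
  rw [Ideal.map_le_iff_le_comap]
  exact fun x hx => Ideal.pow_mem_pow hx _

theorem pow_mul_mem_map_cartierEval {c : R}
    (hc : ∀ x : R, c * x ∈ (cartierEval p 1 x).map (iterateFrobenius R p 1)) (e : ℕ) :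
    ∀ x : R, c ^ p ^ e * x ∈ (cartierEval p e x).map (iterateFrobenius R p e) := by
  -- Each induction step replaces `n` by `p n + 1`; the strict bound `n < p ^ e` survives this.
  suffices h : ∀ e : ℕ, ∃ n < p ^ e, ∀ x : R,
      c ^ n * x ∈ (cartierEval p e x).map (iterateFrobenius R p e) by
    obtain ⟨n, hn, h⟩ := h e
    intro x
    rw [← Nat.sub_add_cancel hn.le, pow_add, mul_assoc]
    exact Ideal.mul_mem_left _ _ (h x)
  intro e
  induction e with
  | zero =>
    refine ⟨0, by simp, fun x => ?_⟩
    simpa using Ideal.mem_map_of_mem (iterateFrobenius R p 0) (mem_cartierEval_zero (p := p) x)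
  | succ e ih =>
    obtain ⟨n, hn, ih⟩ := ih
    have hp := (Fact.out : p.Prime).two_le
    refine ⟨p * n + 1, ?_, fun x => ?_⟩
    · rw [pow_succ']
      nlinarith
    have hle : (cartierEval p 1 x).map (iterateFrobenius R p 1) ≤
        Submodule.comap (LinearMap.mulLeft R (c ^ (p * n)))
          ((cartierEval p (e + 1) x).map (iterateFrobenius R p (e + 1))) := by
      rw [Ideal.map, Ideal.span_le]
      rintro _ ⟨y, hy, rfl⟩
      have h1 := Ideal.mem_map_of_mem (iterateFrobenius R p 1) (ih y)
      rw [Ideal.map_map, ← iterateFrobenius_add] at h1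
      have h2 : (cartierEval p e y).map (iterateFrobenius R p (1 + e)) ≤
          (cartierEval p (e + 1) x).map (iterateFrobenius R p (e + 1)) := by
        rw [add_comm 1 e]
        exact Ideal.map_mono fun z hz => cartierEval_trans hz hy
      have h3 := h2 h1
      simpa [map_mul, frobenius_def, ← pow_mul, mul_comm n p] using h3
    have := hle (hc x)
    rw [pow_succ, mul_assoc]
    exact this

end FrobeniusRing

/-! ### Existence of uniform test elements. -/

section TestElement

variable {R : Type u} [CommRing R] [IsNoetherianRing R] [IsReduced R] {p : ℕ} [Fact p.Prime]
  [CharP R p]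

/-- `R` acts on `¹R` through `p`-th powers, so a dual basis up to `c` reads `c^p x = ∑ φ_i(x)^p
v_i`. -/
theorem exists_mul_mem_map_cartierEval_one (hF : IsFFinite R p) : ∃ c ∈ ringCirc R,
    ∀ x : R, c * x ∈ (cartierEval p 1 x).map (iterateFrobenius R p 1) := by
  have := finite_frobeniusRing hF 1
  obtain ⟨c, hc, n, v, φ, h⟩ := exists_dualBasis_up_to_ringCirc R (FrobeniusRing R p 1)
  refine ⟨c ^ p ^ 1, pow_mem hc _, fun x => ?_⟩
  have hx := congrArg (toFrob R p 1).symm (h (toFrob R p 1 x))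
  rw [smul_toFrob, RingEquiv.symm_apply_apply, map_sum] at hx
  rw [hx]
  refine Ideal.sum_mem _ fun i _ => ?_
  obtain ⟨y, hy⟩ := (toFrob R p 1).surjective (v i)
  rw [← hy, smul_toFrob, RingEquiv.symm_apply_apply]
  exact Ideal.mul_mem_right _ _
    (Ideal.mem_map_of_mem (iterateFrobenius R p 1) ⟨_, isCartierMap_of_linearMap (φ i), rfl⟩)

/-- After inverting `c`, the ideals `cartierEval p e d` ascend and stabilize at some `J`, and `d`
lies in every power of `J`. As `d` is regular, Krull's intersection theorem forces `J = ⊤`. -/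
theorem exists_pow_mem_cartierEval {c d : R} (hd : d ∈ ringCirc R)
    (hc : ∀ x : R, c * x ∈ (cartierEval p 1 x).map (iterateFrobenius R p 1)) :
    ∃ N e : ℕ, c ^ N ∈ cartierEval p e d := by
  have hc1 : c ∈ cartierEval p 1 (1 : R) := by
    have := (map_iterateFrobenius_le_pow _ 1).trans
      (Ideal.pow_le_self (pow_ne_zero _ (Fact.out : p.Prime).ne_zero)) (hc 1)
    rwa [mul_one] at this
  let A := Localization.Away c
  have hunit : IsUnit (algebraMap R A c) := IsLocalization.Away.algebraMap_isUnit c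
  have hmono : Monotone fun e => (cartierEval p e d).map (algebraMap R A) := by
    refine monotone_nat_of_le_succ fun e => ?_
    rw [Ideal.map_le_iff_le_comap]
    intro y hy
    -- If `c = ψ(1)` with `ψ` being `p^{-1}`-linear, then `y c = ψ(y^p)`, and `y^p` is a multiple of
    -- `y`.
    have h1 : y * c ∈ cartierEval p (e + 1) d := by
      have h2 := mul_mem_cartierEval y hc1
      rw [add_comm]
      refine cartierEval_trans h2 (Ideal.mul_mem_right _ _ (Ideal.pow_mem_of_mem _ hy _ ?_))
      exact pow_pos (Fact.out : p.Prime).pos _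
    have h3 := Ideal.mem_map_of_mem (algebraMap R A) h1
    rw [map_mul, mul_comm, Ideal.unit_mul_mem_iff_mem _ hunit] at h3
    exact h3
  have hA : IsNoetherianRing A := IsLocalization.isNoetherianRing (Submonoid.powers c) _ inferInstance
  obtain ⟨n, hn⟩ := monotone_stabilizes_iff_noetherian.2 hA ⟨_, hmono⟩
  set J := (cartierEval p n d).map (algebraMap R A) with hJ
  have hpow : ∀ i : ℕ, algebraMap R A d ∈ J ^ i := by
    intro i
    obtain ⟨e, hne, hie⟩ : ∃ e, n ≤ e ∧ i ≤ p ^ e :=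
      ⟨max n i, le_max_left _ _, (le_max_right _ _).trans
        (Nat.lt_pow_self (Fact.out : p.Prime).one_lt).le⟩
    have h1 := Ideal.mem_map_of_mem (algebraMap R A)
      (map_iterateFrobenius_le_pow _ e (pow_mul_mem_map_cartierEval hc e d))
    rw [Ideal.map_pow, map_mul, map_pow, Ideal.unit_mul_mem_iff_mem _ (hunit.pow _)] at h1
    have h2 : J = (cartierEval p e d).map (algebraMap R A) := hn e hne
    rw [h2]
    exact Ideal.pow_le_pow_right hie h1
  obtain ⟨r, hr⟩ := (Ideal.mem_iInf_smul_pow_eq_bot_iff J (algebraMap R A d)).1 (by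
    rw [Submodule.mem_iInf]
    intro i
    simpa using hpow i)
  have hreg : algebraMap R A d ∈ nonZeroDivisors A :=
    IsLocalization.map_nonZeroDivisors_le (Submonoid.powers c) A
      (Submonoid.mem_map_of_mem _ (ringCirc_le_nonZeroDivisors R hd))
  have hr1 : (r : A) = 1 := by
    rw [smul_eq_mul] at hr
    have : ((r : A) - 1) * algebraMap R A d = 0 := by rw [sub_mul, hr, one_mul, sub_self]
    exact sub_eq_zero.1 ((mem_nonZeroDivisors_iff_right.1 hreg) _ this)
  have htop : J = ⊤ := (Ideal.eq_top_iff_one _).2 (hr1 ▸ r.2)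
  by_contra hcon
  push Not at hcon
  refine (IsLocalization.map_algebraMap_ne_top_iff_disjoint (Submonoid.powers c) A
    (cartierEval p n d)).2 ?_ htop
  rw [Set.disjoint_left]
  rintro _ ⟨N, rfl⟩ h
  exact hcon N n h

/-- Uniform test elements: some `c ∈ R°` is, for every `d ∈ R°`, a value at `d` of
`p^{-e}`-linear maps with `e` arbitrarily large. -/
theorem exists_uniform_test_element (hF : IsFFinite R p) : ∃ c ∈ ringCirc R,
    ∀ d ∈ ringCirc R, ∀ e₀ : ℕ, ∃ e ≥ e₀, c ∈ cartierEval p e d := by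
  obtain ⟨c, hcR, hc⟩ := exists_mul_mem_map_cartierEval_one hF
  have hp := (Fact.out : p.Prime)
  have hc1 : c ∈ cartierEval p 1 (1 : R) := by
    have := (map_iterateFrobenius_le_pow _ 1).trans
      (Ideal.pow_le_self (pow_ne_zero _ hp.ne_zero)) (hc 1)
    rwa [mul_one] at this
  -- The square sustains the induction: one factor `c` moves inside as `c^p`, a multiple of `c^2`
  -- since `p ≥ 2`.
  have hsq : ∀ e : ℕ, c ^ 2 ∈ cartierEval p e (1 : R) := by
    intro e
    induction e with
    | zero => simpa using Ideal.mul_mem_left _ (c ^ 2) (mem_cartierEval_zero (p := p) (1 : R))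
    | succ e ih =>
      rw [add_comm, pow_two]
      refine cartierEval_trans (mul_mem_cartierEval c hc1) (Ideal.mul_mem_right _ _ ?_)
      rw [pow_one]
      exact Ideal.mem_of_dvd _ (pow_dvd_pow c hp.two_le) ih
  -- In `c^3 = c · c^2`, the factor `c` moves inside as `c^(p^f)` with `p^f ≥ N`, which absorbs the
  -- exponent `N` depending on `d`.
  refine ⟨c ^ 3, pow_mem hcR _, fun d hd e₀ => ?_⟩
  obtain ⟨N, e, hN⟩ := exists_pow_mem_cartierEval hd hc
  refine ⟨max e₀ N + e, (le_max_left _ _).trans (Nat.le_add_right _ _), ?_⟩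
  rw [pow_succ']
  refine cartierEval_trans (mul_mem_cartierEval c (hsq _)) (Ideal.mul_mem_right _ _ ?_)
  have hle : N ≤ p ^ max e₀ N := (le_max_right _ _).trans (Nat.lt_pow_self hp.one_lt).le
  exact Ideal.mem_of_dvd _ (pow_dvd_pow c hle) hN

end TestElement

/-! ### Powers in graded families. -/

namespace GradedFamily

variable {R : Type u} [CommRing R]

theorem pow_mem_ideal (𝔞 : GradedFamily R) {m : ℕ} {y : R} (hy : y ∈ 𝔞.ideal m) (j : ℕ) :
    y ^ j ∈ 𝔞.ideal (m * j) := by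
  induction j with
  | zero => simp [𝔞.ideal_zero]
  | succ j ih =>
    rw [pow_succ, mul_add_one]
    exact 𝔞.mul_le' _ _ (Ideal.mul_mem_mul ih hy)

/-- Up to a multiplier that does not depend on the exponent, `Q`-th powers of elements of `𝔞_m` lie
in every `𝔞_n` with `n ≤ mQ`. -/
theorem pow_mul_pow_mem_ideal (𝔞 : GradedFamily R) {u y : R} {m n Q : ℕ} (hu : u ∈ 𝔞.ideal 1)
    (hy : y ∈ 𝔞.ideal m) (h : n ≤ m * Q) : u ^ m * y ^ Q ∈ 𝔞.ideal n := by
  rcases Nat.eq_zero_or_pos m with rfl | hm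
  · obtain rfl : n = 0 := by simpa using h
    simp [𝔞.ideal_zero]
  -- Division of `n` by `m`: powers of `y` cover the quotient, and fewer than `m` factors `u` cover
  -- the remainder.
  have h1 : u ^ (n % m) * y ^ (n / m) ∈ 𝔞.ideal n := by
    have := 𝔞.mul_le' _ _ (Ideal.mul_mem_mul (𝔞.pow_mem_ideal hu (n % m))
      (𝔞.pow_mem_ideal hy (n / m)))
    rwa [one_mul, Nat.mod_add_div] at this
  refine Ideal.mem_of_dvd _ (mul_dvd_mul (pow_dvd_pow u (Nat.mod_lt n hm).le)
    (pow_dvd_pow y ?_)) h1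
  exact Nat.div_le_of_le_mul h

theorem mul_le_add_ideal (𝔞 𝔟 : GradedFamily R) (k l : ℕ) :
    𝔞.ideal k * 𝔟.ideal l ≤ (𝔞 + 𝔟).ideal (k + l) := by
  rw [add_ideal, Ideal.sum_eq_sup]
  exact Finset.le_sup (f := fun kl : ℕ × ℕ => 𝔞.ideal kl.1 * 𝔟.ideal kl.2) (b := (k, l))
    (by simp)

end GradedFamily

/-! ### Passing from level `e` to level `e + f`; splitting the exponent. -/

section Comparison

variable {R : Type u} [CommRing R] {p : ℕ}

theorem ceil_mul_pow_add_le {t : ℝ} {m e : ℕ} (h : t * (p : ℝ) ^ e ≤ m) (f : ℕ) :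
    ⌈t * (p : ℝ) ^ (e + f)⌉₊ ≤ m * p ^ f := by
  rw [Nat.ceil_le, pow_add, ← mul_assoc]
  push_cast
  gcongr

/-- If `c` is a value of `p^{-f}`-linear maps at `d v` for large `f`, and `v x^(p^f)` lies in
`J_{e+f}`, then the values at `c x` of `p^{-e}`-linear maps lie in the Cartier sum of `J`. -/
theorem cartierEval_le_cartierSum_of_pow_mem {J : ℕ → Ideal R} {c d v x : R} {e e₀ f : ℕ}
    (hf : e₀ ≤ f) (hc : c ∈ cartierEval p f (d * v)) (hx : v * x ^ p ^ f ∈ J (e + f)) :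
    cartierEval p e (c * x) ≤ cartierSum p J d e₀ := by
  intro z hz
  refine cartierEval_le_cartierSum d (hf.trans (Nat.le_add_left f e)) hx (cartierEval_trans hz ?_)
  have := mul_mem_cartierEval x hc
  rwa [mul_comm x c, mul_comm (x ^ p ^ f), mul_assoc] at this

/-- The ideal of all `x` such that the values at `c x` of `p^{-e}`-linear maps lie in `T`. -/
def cartierPreimage (p e : ℕ) (c : R) (T : Ideal R) : Ideal R where
  carrier := {x | cartierEval p e (c * x) ≤ T}
  zero_mem' := by
    rintro _ ⟨φ, -, rfl⟩
    simp
  add_mem' := by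
    rintro x y hx hy _ ⟨φ, hφ, rfl⟩
    rw [mul_add, map_add]
    exact T.add_mem (hx ⟨φ, hφ, rfl⟩) (hy ⟨φ, hφ, rfl⟩)
  smul_mem' := by
    intro a x hx
    rw [Set.mem_ofPred_eq, smul_eq_mul, mul_left_comm]
    exact (cartierEval_mul_le e a _).trans hx

/-- Rounding up can make `k/q + l/q` exceed `t`, so `r` is `k/q` capped at `t` and `s` is what
remains. -/
theorem exists_add_eq_of_add_eq_ceil {t q : ℝ} (hq : 0 < q) (ht : 0 < t) {k l : ℕ}
    (h : k + l = ⌈t * q⌉₊) :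
    ∃ r s : ℝ, 0 ≤ r ∧ 0 ≤ s ∧ r + s = t ∧ r * q ≤ k ∧ s * q ≤ l := by
  have hkl : t * q ≤ k + l := by
    have := Nat.le_ceil (t * q)
    rw [← h] at this
    exact_mod_cast this
  refine ⟨min (k / q) t, t - min (k / q) t, le_min (by positivity) ht.le,
    sub_nonneg.2 (min_le_right _ _), by ring, ?_, ?_⟩
  · exact (mul_le_mul_of_nonneg_right (min_le_left _ _) hq.le).trans_eq (div_mul_cancel₀ _ hq.ne')
  · rcases min_cases ((k : ℝ) / q) t with ⟨h1, -⟩ | ⟨h1, -⟩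
    · rw [h1, sub_mul, div_mul_cancel₀ _ hq.ne']
      linarith
    · rw [h1]
      simp

end Comparison

/-! ### The two comparisons between sum and mixed test ideals. -/

section Subadditivity

variable {R : Type u} [CommRing R] [IsNoetherianRing R] {p : ℕ} [Fact p.Prime] [CharP R p]

theorem mixedTestIdeal_le_testIdeal_add (hF : IsFFinite R p) {c : R} (hcR : c ∈ ringCirc R)
    (hc : ∀ d ∈ ringCirc R, ∀ e₀ : ℕ, ∃ e ≥ e₀, c ∈ cartierEval p e d)
    (𝔞 𝔟 : GradedFamily R) (r s : ℝ) :
    mixedTestIdeal p 𝔞 𝔟 r s ≤ testIdeal p (𝔞 + 𝔟) (r + s) := by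
  intro a ha
  refine (mem_annihilator_zeroTightClosure_iff hF _ _).2 fun d hd e₀ => ?_
  refine (?_ : cartierSum p _ c 0 ≤ _) ((mem_annihilator_zeroTightClosure_iff hF _ _).1 ha c hcR 0)
  refine iSup₂_le fun e _ => iSup₂_le fun x hx => ?_
  obtain ⟨u, hu, huR⟩ := (𝔞 + 𝔟).exists_mem_one
  have hx' := 𝔞.mul_le_add_ideal 𝔟 _ _ hx
  set m := ⌈r * (p : ℝ) ^ e⌉₊ + ⌈s * (p : ℝ) ^ e⌉₊ with hm
  -- `m` may exceed `⌈(r + s) p^e⌉`; only this lower bound is needed.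
  have hceil : (r + s) * (p : ℝ) ^ e ≤ m := by
    rw [hm, add_mul]
    push_cast
    exact add_le_add (Nat.le_ceil _) (Nat.le_ceil _)
  obtain ⟨f, hf, hcf⟩ := hc (d * u ^ m) (mul_mem hd (pow_mem huR m)) e₀
  exact cartierEval_le_cartierSum_of_pow_mem hf hcf
    ((𝔞 + 𝔟).pow_mul_pow_mem_ideal hu hx' (ceil_mul_pow_add_le hceil f))

theorem cartierEval_mul_le_mixedTestIdeal (hF : IsFFinite R p) {c : R}
    (hc : ∀ d ∈ ringCirc R, ∀ e₀ : ℕ, ∃ e ≥ e₀, c ∈ cartierEval p e d)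
    (𝔞 𝔟 : GradedFamily R) {r s : ℝ} {e k l : ℕ} (hk : r * (p : ℝ) ^ e ≤ k)
    (hl : s * (p : ℝ) ^ e ≤ l) {x y : R} (hx : x ∈ 𝔞.ideal k) (hy : y ∈ 𝔟.ideal l) :
    cartierEval p e (c * (x * y)) ≤ mixedTestIdeal p 𝔞 𝔟 r s := by
  intro a ha
  refine (mem_annihilator_zeroTightClosure_iff hF _ _).2 fun d hd e₀ => ?_
  obtain ⟨u, hu, huR⟩ := 𝔞.exists_mem_one
  obtain ⟨w, hw, hwR⟩ := 𝔟.exists_mem_one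
  obtain ⟨f, hf, hcf⟩ := hc (d * (u ^ k * w ^ l))
    (mul_mem hd (mul_mem (pow_mem huR k) (pow_mem hwR l))) e₀
  refine cartierEval_le_cartierSum_of_pow_mem hf hcf ?_ ha
  rw [mul_pow, mul_mul_mul_comm]
  exact Ideal.mul_mem_mul (𝔞.pow_mul_pow_mem_ideal hu hx (ceil_mul_pow_add_le hk f))
    (𝔟.pow_mul_pow_mem_ideal hw hy (ceil_mul_pow_add_le hl f))

end Subadditivity

theorem testIdeal_add {R : Type u} [CommRing R] [IsNoetherianRing R] [IsReduced R]
    (p : ℕ) [Fact p.Prime] [CharP R p] (hF : IsFFinite R p)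
    (𝔞 𝔟 : GradedFamily R) (t : ℝ) (ht : 0 < t) :
    testIdeal p (𝔞 + 𝔟) t =
      ⨆ (l : ℝ) (m : ℝ) (_ : 0 ≤ l) (_ : 0 ≤ m) (_ : l + m = t),
        mixedTestIdeal p 𝔞 𝔟 l m := by
  obtain ⟨c, hcR, hc⟩ := exists_uniform_test_element hF
  have hp := (Fact.out : p.Prime)
  refine le_antisymm ?_ (iSup₂_le fun r s => iSup₂_le fun _ _ => iSup_le fun hrs =>
    hrs ▸ mixedTestIdeal_le_testIdeal_add hF hcR hc 𝔞 𝔟 r s)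
  intro a ha
  refine (?_ : cartierSum p _ c 0 ≤ _) ((mem_annihilator_zeroTightClosure_iff hF _ _).1 ha c hcR 0)
  refine iSup₂_le fun e _ => ?_
  -- Since the condition on `x` defines an ideal, it suffices to test products of generators.
  suffices h : (𝔞 + 𝔟).ideal ⌈t * (p : ℝ) ^ e⌉₊ ≤ cartierPreimage p e c _ from
    iSup₂_le fun x hx => h hx
  rw [GradedFamily.add_ideal, Ideal.sum_eq_sup]
  refine Finset.sup_le fun ⟨k, l⟩ hkl => Ideal.mul_le.2 fun x hx y hy => ?_
  have hq : (0 : ℝ) < (p : ℝ) ^ e := pow_pos (Nat.cast_pos.2 hp.pos) e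
  -- The pair `(r, s)` depends on `e`, `k`, `l`; this is harmless because the supremum runs over all
  -- real pairs.
  obtain ⟨r, s, hr, hs, hrs, hrk, hsl⟩ :=
    exists_add_eq_of_add_eq_ceil hq ht (Finset.HasAntidiagonal.mem_antidiagonal.1 hkl)
  refine (cartierEval_mul_le_mixedTestIdeal hF hc 𝔞 𝔟 hrk hsl hx hy).trans ?_
  exact le_iSup₂_of_le r s (le_iSup₂_of_le hr hs (le_iSup_of_le hrs le_rfl))

end AsymptoticTestIdeal

theorem proposition4p9 {R : Type u} [CommRing R] [IsNoetherianRing R] [IsReduced R]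
    (p : ℕ) [Fact p.Prime] [CharP R p] (hF : AsymptoticTestIdeal.IsFFinite R p)
    (𝔞 𝔟 : AsymptoticTestIdeal.GradedFamily R) (t : ℝ) (ht : 0 < t) :
    AsymptoticTestIdeal.testIdeal p (𝔞 + 𝔟) t =
      ⨆ (l : ℝ) (m : ℝ) (_ : 0 ≤ l) (_ : 0 ≤ m) (_ : l + m = t),
        AsymptoticTestIdeal.mixedTestIdeal p 𝔞 𝔟 l m :=
  AsymptoticTestIdeal.testIdeal_add p hF 𝔞 𝔟 t ht
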